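/- There are absolute constants $C,K>0$ with the following property. Let $A\in\mathbb{R}^{m\times n}$, let $1\le k\le \operatorname{rank}(A)$, and let $A=U\Sigma V^T$ be a singular value decomposition with singular values in decreasing order; let $U_k$ be the matrix of the top-$k$ left singular vectors, and let $A_k=U_k\Sigma_kV_k^T$ be the corresponding best rank-$k$ approximation of $A$. Suppose that the top-$k$ column space is incoherent, $\frac mk\max_i\|U_k^Te_i\|_2^2\le\mu_0$. Let the columns of $A$ be partitioned into $G$ predefined blocks, and let $E_i$ consist of the columns of the identity matrix $I_n$ that belong to block $i$. Let $\varepsilon,\delta\in(0,1)$. One run of the Block CUR algorithm is the following. (1) Draw $r$ rows of $A$ independently and uniformly, and put $R=S_R^TA\in\mathbb{R}^{r\times n}$, where column $t$ of $S_R$ is $\sqrt{m/r}\,e_{i}$ if the $t$-th drawn row is row $i$. (2) Let $V_R\in\mathbb{R}^{n\times q}$ consist of $q$ right singular vectors of $R$, taken from a singular value decomposition $R=U_R\Sigma_RV_R^T$ with $q\ge1$ singular triples in decreasing order (so $\operatorname{rank}R\le q\le\min(r,n)$; singular values beyond the rank are $0$). Let $p_i=\|V_R^TE_i\|_F^2/q$,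 and let $\alpha_R=\min_i \|V_R^TE_i\|_F^2/\|V_R^TE_i\|_2^2$ (over the blocks with $V_R^TE_i\ne0$) be the block stable rank. Draw $g$ blocks $j_1,\dots,j_g$ independently with the probabilities $p_i$, where $g$ may depend on $R$, and let $S=\bigl[E_{j_1}/\sqrt{g\,p_{j_1}},\dots,E_{j_g}/\sqrt{g\,p_{j_g}}\bigr]$ be the corresponding block sampling and scaling matrix. (3) Output $CUR$ with $C=AS$ and $U=(RS)^\dagger$. Run this independently $T\ge1$ times, and return the output $CUR$ with the smallest error $\|A-CUR\|_F$. If $$T\ge\ln\tfrac1\delta,\qquad r\ge C\,\frac{\mu_0k^2}{\varepsilon^2},\qquad g\ge C\,\frac{r^2}{\alpha_R\,\varepsilon^2}\ \text{ for every possible } R,$$ then, whichever singular value decompositions of the matrices $R$ are used, the returned approximation satisfies, with probability at least $1-\delta$, $$\|A-CUR\|_F\le(1+\varepsilon)\,\|A-A_k\|_F .$$ Moreover, $T$, $r$ and $g$ can be chosen subject to these conditions such that the total number of rows drawn is $Tr\le K\,\frac{\mu_0k^2}{\varepsilon^2}\max\{1,\ln\frac1\delta\}$, and, for every possible $R$,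 $Tg\le K\,\frac{r^2}{\alpha_R\varepsilon^2}\max\{1,\ln\frac1\delta\}$. -/

import Mathlib

open Matrix
open scoped ENNReal

noncomputable section

namespace BlockCUR

/-! ### Norms -/

/-- The Frobenius norm of a real matrix. -/
def frobNorm {ι κ : Type*} [Fintype ι] [Fintype κ] (A : Matrix ι κ ℝ) : ℝ :=
  √(∑ i, ∑ j, A i j ^ 2)

/-- The spectral norm of a real matrix: the operator norm with respect to Euclidean norms. -/
def specNorm {ι κ : Type*} [Fintype ι] [Fintype κ] [DecidableEq κ] (A : Matrix ι κ ℝ) : ℝ :=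
  ‖LinearMap.toContinuousLinearMap (Matrix.toEuclideanLin A)‖

/-! ### The Moore-Penrose pseudoinverse -/

/-- The four Penrose equations: `X` is the pseudoinverse of `A`. -/
structure IsPinv {ι κ : Type*} [Fintype ι] [Fintype κ]
    (A : Matrix ι κ ℝ) (X : Matrix κ ι ℝ) : Prop where
  mul_mul_self : A * X * A = A
  mul_mul_inv : X * A * X = X
  symm_left : (A * X)ᵀ = A * X
  symm_right : (X * A)ᵀ = X * A

theorem exists_isPinv {ι κ : Type*} [Fintype ι] [Fintype κ] [DecidableEq κ]
    (A : Matrix ι κ ℝ) : ∃ X, IsPinv A X := by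
  have hH : (Aᵀ * A).IsHermitian := by
    simpa [conjTranspose_eq_transpose_of_trivial] using isHermitian_conjTranspose_mul_self A
  obtain ⟨W, d, hW, hspec⟩ : ∃ (W : Matrix κ κ ℝ) (d : κ → ℝ), Wᵀ * W = 1 ∧
      Aᵀ * A = W * diagonal d * Wᵀ := by
    refine ⟨hH.eigenvectorUnitary, hH.eigenvalues, ?_, ?_⟩
    · have := (Matrix.mem_unitaryGroup_iff').1 hH.eigenvectorUnitary.2
      simpa [star_eq_conjTranspose, conjTranspose_eq_transpose_of_trivial] using this
    · have := hH.spectral_theorem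
      rw [Unitary.conjStarAlgAut_apply] at this
      simpa [star_eq_conjTranspose, conjTranspose_eq_transpose_of_trivial,
        Function.comp_def] using this
  have key : ∀ u v : κ → ℝ, (W * diagonal u * Wᵀ) * (W * diagonal v * Wᵀ) =
      W * diagonal (fun i => u i * v i) * Wᵀ := by
    intro u v
    rw [← diagonal_mul_diagonal]
    calc _ = W * diagonal u * (Wᵀ * W) * diagonal v * Wᵀ := by simp only [Matrix.mul_assoc]
      _ = _ := by rw [hW]; simp only [Matrix.mul_assoc, Matrix.one_mul]
  have hsymm : ∀ u : κ → ℝ, (W * diagonal u * Wᵀ)ᵀ = W * diagonal u * Wᵀ := by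
    intro u
    simp [Matrix.transpose_mul, Matrix.mul_assoc]
  set N := W * diagonal (fun i => (d i)⁻¹) * Wᵀ with hN
  set P := W * diagonal (fun i => (d i)⁻¹ * d i) * Wᵀ with hP
  have hNH : N * (Aᵀ * A) = P := by rw [hspec, hN, key]
  have hPN : P * N = N := by
    rw [hN, hP, key]
    congr 3
    funext i
    by_cases h : d i = 0 <;> simp [h]
  have hHP : (Aᵀ * A) * P = Aᵀ * A := by
    rw [hspec, hP, key]
    congr 3
    funext i
    by_cases h : d i = 0 <;> simp [h]
  have hAP : A * P = A := by
    have h0 : (A * P - A)ᵀ * (A * P - A) = 0 := by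
      have : Aᵀ * (A * P - A) = 0 := by
        rw [Matrix.mul_sub, ← Matrix.mul_assoc, hHP, sub_self]
      rw [transpose_sub, transpose_mul, Matrix.sub_mul, Matrix.mul_assoc, this]
      simp
    rw [← conjTranspose_eq_transpose_of_trivial] at h0
    exact sub_eq_zero.1 (conjTranspose_mul_self_eq_zero.1 h0)
  have hXA : N * Aᵀ * A = P := by rw [Matrix.mul_assoc, hNH]
  refine ⟨N * Aᵀ, ?_, ?_, ?_, ?_⟩
  · rw [Matrix.mul_assoc, hXA, hAP]
  · rw [hXA, ← Matrix.mul_assoc, hPN]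
  · rw [transpose_mul, transpose_mul, transpose_transpose, hsymm, Matrix.mul_assoc]
  · rw [hXA, hsymm]

/-- The Moore-Penrose pseudoinverse `A†`. -/
def pinv {ι κ : Type*} [Fintype ι] [Fintype κ] (A : Matrix ι κ ℝ) : Matrix κ ι ℝ :=
  haveI := Classical.decEq κ
  (exists_isPinv A).choose

theorem isPinv_pinv {ι κ : Type*} [Fintype ι] [Fintype κ] (A : Matrix ι κ ℝ) :
    IsPinv A (pinv A) :=
  haveI := Classical.decEq κ
  (exists_isPinv A).choose_spec

/-- The Penrose equations determine the pseudoinverse. -/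
theorem IsPinv.eq_pinv {ι κ : Type*} [Fintype ι] [Fintype κ] {A : Matrix ι κ ℝ}
    {X : Matrix κ ι ℝ} (h : IsPinv A X) : X = pinv A := by
  have h' := isPinv_pinv A
  set Y := pinv A
  have e1 : A * X = A * Y := by
    calc A * X = (A * X)ᵀ := h.symm_left.symm
      _ = ((A * Y) * (A * X))ᵀ := by rw [← Matrix.mul_assoc, h'.mul_mul_self]
      _ = (A * X) * (A * Y) := by rw [transpose_mul, h.symm_left, h'.symm_left]
      _ = A * Y := by rw [← Matrix.mul_assoc, h.mul_mul_self]
  have e2 : X * A = Y * A := by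
    calc X * A = (X * A)ᵀ := h.symm_right.symm
      _ = ((X * A) * (Y * A))ᵀ := by
        rw [Matrix.mul_assoc X, ← Matrix.mul_assoc A, h'.mul_mul_self]
      _ = (Y * A) * (X * A) := by rw [transpose_mul, h.symm_right, h'.symm_right]
      _ = Y * A := by rw [Matrix.mul_assoc Y, ← Matrix.mul_assoc A, h.mul_mul_self]
  calc X = X * A * X := h.mul_mul_inv.symm
    _ = Y * A * Y := by rw [e2, Matrix.mul_assoc, e1, ← Matrix.mul_assoc]
    _ = Y := h'.mul_mul_inv

/-! ### Singular value decompositions -/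

/-- A (reduced) singular value decomposition `A = U Σ Vᵀ` of `A` with `q` singular triples, in
decreasing order of the singular values.  The columns of `U` and `V` are left and right singular
vectors.  The equation forces `rank A ≤ q`; singular values beyond the rank are zero. -/
structure SVD {m n : ℕ} (A : Matrix (Fin m) (Fin n) ℝ) (q : ℕ) where
  U : Matrix (Fin m) (Fin q) ℝ
  σ : Fin q → ℝ
  V : Matrix (Fin n) (Fin q) ℝ
  orthonormal_U : Uᵀ * U = 1
  orthonormal_V : Vᵀ * V = 1
  nonneg : ∀ i, 0 ≤ σ i
  antitone : Antitone σ
  eq : A = U * diagonal σ * Vᵀ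

namespace SVD

variable {m n q : ℕ} {A : Matrix (Fin m) (Fin n) ℝ}

/-- The matrix of the top-`k` left singular vectors. -/
def topU (D : SVD A q) (k : ℕ) (hk : k ≤ q) : Matrix (Fin m) (Fin k) ℝ :=
  D.U.submatrix id (Fin.castLE hk)

/-- The matrix of the top-`k` right singular vectors. -/
def topV (D : SVD A q) (k : ℕ) (hk : k ≤ q) : Matrix (Fin n) (Fin k) ℝ :=
  D.V.submatrix id (Fin.castLE hk)

/-- The best rank-`k` approximation `A_k = U_k Σ_k V_kᵀ`. -/
def trunc (D : SVD A q) (k : ℕ) (hk : k ≤ q) : Matrix (Fin m) (Fin n) ℝ :=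
  D.topU k hk * diagonal (fun i => D.σ (Fin.castLE hk i)) * (D.topV k hk)ᵀ

/-- The top-`k` column space incoherence `(m / k) max_i ‖U_kᵀ e_i‖²`. -/
def incoherence (D : SVD A q) (k : ℕ) (hk : k ≤ q) : ℝ :=
  (m : ℝ) / k * ⨆ i : Fin m, ∑ l : Fin k, D.topU k hk i l ^ 2

end SVD

/-! ### Column blocks

The columns are partitioned into `G` predefined blocks by a map `blk : Fin n → Fin G`. -/

/-- `E_i`: the columns of the identity matrix that belong to block `i`. -/
def blockE {n G : ℕ} (blk : Fin n → Fin G) (i : Fin G) :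
    Matrix (Fin n) {j : Fin n // blk j = i} ℝ :=
  (1 : Matrix (Fin n) (Fin n) ℝ).submatrix id Subtype.val

/-- The block leverage score `‖Vᵀ E_i‖_F²`. -/
def blockScore {n q G : ℕ} (blk : Fin n → Fin G) (V : Matrix (Fin n) (Fin q) ℝ) (i : Fin G) : ℝ :=
  frobNorm (Vᵀ * blockE blk i) ^ 2

/-- The block stable rank `min_i ‖Vᵀ E_i‖_F² / ‖Vᵀ E_i‖_2²`.  Blocks on which the singular vectors
vanish (for which the quotient is `0 / 0`) are left out of the minimum. -/
def blockStableRank {n q G : ℕ} (blk : Fin n → Fin G) (V : Matrix (Fin n) (Fin q) ℝ) : ℝ :=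
  ⨅ i : {i : Fin G // Vᵀ * blockE blk i ≠ 0},
    frobNorm (Vᵀ * blockE blk i.1) ^ 2 / specNorm (Vᵀ * blockE blk i.1) ^ 2

theorem blockScore_eq {n q G : ℕ} (blk : Fin n → Fin G) (V : Matrix (Fin n) (Fin q) ℝ)
    (i : Fin G) :
    blockScore blk V i = ∑ j with blk j = i, ∑ l, V j l ^ 2 := by
  have h : Vᵀ * blockE blk i = Vᵀ.submatrix id Subtype.val := by
    ext l j
    simp [blockE, Matrix.mul_apply, Matrix.one_apply]
  rw [blockScore, frobNorm, h, Real.sq_sqrt (by positivity), Finset.sum_comm,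
    ← Finset.sum_subtype_eq_sum_filter]
  simp [Finset.subtype_univ]

theorem sum_blockScore {n q G : ℕ} (blk : Fin n → Fin G) (V : Matrix (Fin n) (Fin q) ℝ)
    (hV : Vᵀ * V = 1) : ∑ i, blockScore blk V i = q := by
  simp_rw [blockScore_eq]
  rw [Finset.sum_fiberwise, Finset.sum_comm]
  have h : ∀ l : Fin q, ∑ j, V j l ^ 2 = 1 := by
    intro l
    have := congrFun (congrFun hV l) l
    simpa [Matrix.mul_apply, pow_two] using this
  simp [h]

/-! ### Sampling -/

/-- The probabilities `p_i = ‖Vᵀ E_i‖_F² / q` with which a block is drawn, where `V` consists of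
`q` right singular vectors. -/
def blockProb {n q G : ℕ} (blk : Fin n → Fin G) (V : Matrix (Fin n) (Fin q) ℝ) (i : Fin G) : ℝ :=
  blockScore blk V i / q

/-- The law of one draw of a block. -/
def blockLaw {n q G : ℕ} (blk : Fin n → Fin G) (V : Matrix (Fin n) (Fin q) ℝ)
    (hV : Vᵀ * V = 1) (hq : 0 < q) : PMF (Fin G) :=
  PMF.ofFintype (fun i => ENNReal.ofReal (blockProb blk V i)) (by
    have hq' : (q : ℝ) ≠ 0 := by positivity
    have h0 : ∀ i ∈ Finset.univ, 0 ≤ blockProb blk V i :=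
      fun i _ => div_nonneg (sq_nonneg _) (Nat.cast_nonneg q)
    rw [← ENNReal.ofReal_sum_of_nonneg h0]
    simp only [blockProb]
    rw [← Finset.sum_div, sum_blockScore blk V hV, div_self hq', ENNReal.ofReal_one])

/-- The law of `N` independent draws from `p`. -/
def iid {α : Type*} [Fintype α] (p : PMF α) (N : ℕ) : PMF (Fin N → α) :=
  PMF.ofFintype (fun f => ∏ t, p (f t)) (by
    classical
    have h := Finset.prod_univ_sum (fun _ : Fin N => (Finset.univ : Finset α))
      (fun _ a => p a)
    rw [Fintype.piFinset_univ] at h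
    rw [← h]
    have hp : ∑ a, p a = 1 := by rw [← tsum_fintype (L := .unconditional _)]; exact p.tsum_coe
    simp [hp])

/-- The row sampling matrix `S_R` for the drawn rows `ρ`: its `t`-th column has the entry
`1 / √(r p)` with `p = 1 / m` at the drawn row and zeros elsewhere. -/
def rowSampling {m r : ℕ} (ρ : Fin r → Fin m) : Matrix (Fin m) (Fin r) ℝ :=
  fun i t => if i = ρ t then 1 / √(r * (1 / m)) else 0

/-- The row matrix `R = S_Rᵀ A`. -/
def rowMatrix {m n r : ℕ} (A : Matrix (Fin m) (Fin n) ℝ) (ρ : Fin r → Fin m) :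
    Matrix (Fin r) (Fin n) ℝ :=
  (rowSampling ρ)ᵀ * A

/-- The column block sampling matrix `S` for the drawn blocks `J` and the probabilities `p`: its
`t`-th block of columns has the identity matrix scaled by `1 / √(g p_{J t})` at the drawn block,
and zeros elsewhere. -/
def blockSampling {n G g : ℕ} (blk : Fin n → Fin G) (p : Fin G → ℝ) (J : Fin g → Fin G) :
    Matrix (Fin n) (Σ t : Fin g, {j : Fin n // blk j = J t}) ℝ :=
  fun i c => if i = c.2.1 then 1 / √(g * p (J c.1)) else 0

/-- The approximation `C U R` of `A` with `C = A S` and `U = (R S)†`. -/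
def curApprox {m n r : ℕ} {κ : Type*} [Fintype κ] (A : Matrix (Fin m) (Fin n) ℝ)
    (R : Matrix (Fin r) (Fin n) ℝ) (S : Matrix (Fin n) κ ℝ) : Matrix (Fin m) (Fin n) ℝ :=
  (A * S) * pinv (R * S) * R

/-! ### The algorithm

It uses a routine `svd` that returns, for the matrix `R` of sampled rows, a singular value
decomposition with `q` singular triples (`rank R ≤ q`, `0 < q`), and a rule `g` that says how many
blocks are drawn after `R` has been drawn. -/

/-- The random choices of one run: the drawn rows, and then the drawn column blocks. -/
abbrev Run (m G r : ℕ) (g : (Fin r → Fin m) → ℕ) : Type :=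
  Σ ρ : Fin r → Fin m, (Fin (g ρ) → Fin G)

section Algorithm

variable {m n G r : ℕ} (A : Matrix (Fin m) (Fin n) ℝ) (blk : Fin n → Fin G)
  {q : (Fin r → Fin m) → ℕ} (svd : ∀ ρ, SVD (rowMatrix A ρ) (q ρ))

/-- The law of one run: `r` independent uniform rows; then, given these, `g` independent
blocks drawn by the block leverage scores of the sampled rows `R`. -/
def runLaw [NeZero m] (hq : ∀ ρ, 0 < q ρ) (g : (Fin r → Fin m) → ℕ) : PMF (Run m G r g) :=
  (iid (PMF.uniformOfFintype (Fin m)) r).bind fun ρ =>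
    (iid (blockLaw blk (svd ρ).V (svd ρ).orthonormal_V (hq ρ)) (g ρ)).map (Sigma.mk ρ)

/-- The output `C U R` of one run. -/
def runOutput {g : (Fin r → Fin m) → ℕ} (ω : Run m G r g) : Matrix (Fin m) (Fin n) ℝ :=
  curApprox A (rowMatrix A ω.1) (blockSampling blk (blockProb blk (svd ω.1).V) ω.2)

/-- Among `T` runs, one whose output has the smallest Frobenius error. -/
def bestRun {T : ℕ} (hT : 0 < T) {g : (Fin r → Fin m) → ℕ} (ω : Fin T → Run m G r g) : Fin T :=
  haveI : Nonempty (Fin T) := ⟨⟨0, hT⟩⟩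
  (Finite.exists_min fun τ => frobNorm (A - runOutput A blk svd (ω τ))).choose

/-- The output `C U R` of `T` runs: that of the best run. -/
def boostedOutput {T : ℕ} (hT : 0 < T) {g : (Fin r → Fin m) → ℕ} (ω : Fin T → Run m G r g) :
    Matrix (Fin m) (Fin n) ℝ :=
  runOutput A blk svd (ω (bestRun A blk svd hT ω))

end Algorithm

end BlockCUR

end

/-!
# Block CUR approximation

A single run succeeds with probability at least `3 / 4 ≥ 1 - 1 / e`; the best of `T ≥ ln (1 / δ)`
independent runs fails only if all of them fail (`not_le_of_not_boostedOutput_le`), hence with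
probability at most `e ^ (-T) ≤ δ`.

Both sampling steps of a run rest on one variance bound. If `S` samples coordinate blocks `E_i`
with probabilities `p_i` that dominate the leverage of the blocks with respect to `V` up to a
factor `β`, then `X S Sᵀ V` has mean `X V` and variance at most `β ‖X‖_F² / N`
(`expect_sampleGram_sub_sq_le`). For uniform rows and `V = U_k`, incoherence gives `β = μ₀ k`; for
the blocks and `V = V_R`, block stable rank `α` gives `β = q / α` with `q ≤ r`. By Markov's
inequality `S Sᵀ` then nearly preserves the Gram matrix of `V` (take `X = Vᵀ`), within `1 / 2` in
the Frobenius norm; this is where the squares `k ^ 2` and `r ^ 2` are used. And it nearly preserves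
the product of `V` with the residual `B`, within `ε / 2 * ‖B‖_F`.

These two events suffice for the sampled least squares problems. The residual of such a problem
is the optimal residual `B` plus an orthogonal correction `D`. The normal equations of the sampled
problem bound `‖D‖_F` by half of itself plus `ε / 2 * ‖B‖_F`, so `‖D‖_F ≤ ε ‖B‖_F`, without any
matrix inversion. For the rows, this gives `‖A - A R† R‖_F² ≤ (1 + ε²) ‖A - A_k‖_F²`
(`exists_row_approx`, `frobNorm_sub_mul_pinv_mul_le`). For the columns, `A S (R S)†` solves the
problem `min_X ‖(A - X R) S‖_F`, and `‖A - C U R‖_F² ≤ (1 + ε²) ‖A - A R† R‖_F²`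
(`frobNorm_sub_curApprox_sq_le`). Finally `(1 + ε²)² ≤ (1 + ε)²`.

For the sample sizes, rounding up costs only a constant factor, because `μ₀ ≥ 1`, and because
`1 ≤ α ≤ q ≤ r` makes `r² / (α ε²)` at least `1`.
-/

namespace BlockCUR

/-! ### The Frobenius and the spectral norm -/

section Norms

variable {ι κ τ : Type*} [Fintype ι] [Fintype κ] [Fintype τ]

theorem frobNorm_nonneg (A : Matrix ι κ ℝ) : 0 ≤ frobNorm A := Real.sqrt_nonneg _

theorem frobNorm_sq (A : Matrix ι κ ℝ) : frobNorm A ^ 2 = ∑ i, ∑ j, A i j ^ 2 :=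
  Real.sq_sqrt (by positivity)

theorem frobNorm_transpose (A : Matrix ι κ ℝ) : frobNorm Aᵀ = frobNorm A := by
  simp only [frobNorm, transpose_apply]
  rw [Finset.sum_comm]

section
open scoped Matrix.Norms.Frobenius

theorem frobNorm_eq_norm (A : Matrix ι κ ℝ) : frobNorm A = ‖A‖ := by
  rw [frobenius_norm_def, frobNorm, Real.sqrt_eq_rpow]
  simp

theorem frobNorm_add_le (A B : Matrix ι κ ℝ) : frobNorm (A + B) ≤ frobNorm A + frobNorm B := by
  simpa only [frobNorm_eq_norm] using norm_add_le A B

theorem frobNorm_mul_le (A : Matrix ι κ ℝ) (B : Matrix κ τ ℝ) :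
    frobNorm (A * B) ≤ frobNorm A * frobNorm B := by
  simpa only [frobNorm_eq_norm] using frobenius_norm_mul A B

theorem frobNorm_neg (A : Matrix ι κ ℝ) : frobNorm (-A) = frobNorm A := by
  simp only [frobNorm_eq_norm, norm_neg]

theorem frobNorm_eq_zero {A : Matrix ι κ ℝ} : frobNorm A = 0 ↔ A = 0 := by
  simp only [frobNorm_eq_norm, norm_eq_zero]

end

theorem frobNorm_sq_eq_trace (A : Matrix ι κ ℝ) : frobNorm A ^ 2 = (A * Aᵀ).trace := by
  rw [frobNorm_sq]
  simp [trace, Matrix.mul_apply, pow_two]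

/-- Pythagoras for matrices with orthogonal row spaces. -/
theorem frobNorm_sq_add {X Y : Matrix ι κ ℝ} (h : X * Yᵀ = 0) :
    frobNorm (X + Y) ^ 2 = frobNorm X ^ 2 + frobNorm Y ^ 2 := by
  have h' : Y * Xᵀ = 0 := by simpa using congrArg transpose h
  simp [frobNorm_sq_eq_trace, Matrix.add_mul, Matrix.mul_add, h, h']

/-- Pythagoras for matrices with orthogonal column spaces. -/
theorem frobNorm_sq_add' {X Y : Matrix ι κ ℝ} (h : Xᵀ * Y = 0) :
    frobNorm (X + Y) ^ 2 = frobNorm X ^ 2 + frobNorm Y ^ 2 := by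
  have := frobNorm_sq_add (X := Xᵀ) (Y := Yᵀ) (by simpa using h)
  rwa [← transpose_add, frobNorm_transpose, frobNorm_transpose, frobNorm_transpose] at this

theorem frobNorm_mul_transpose_of_orthonormal [DecidableEq τ] (X : Matrix ι τ ℝ)
    {V : Matrix κ τ ℝ} (hV : Vᵀ * V = 1) : frobNorm (X * Vᵀ) = frobNorm X := by
  rw [← sq_eq_sq₀ (frobNorm_nonneg _) (frobNorm_nonneg _), frobNorm_sq_eq_trace,
    frobNorm_sq_eq_trace, transpose_mul, transpose_transpose, Matrix.mul_assoc,
    ← Matrix.mul_assoc Vᵀ, hV, Matrix.one_mul]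

theorem frobNorm_mul_of_orthonormal [DecidableEq τ] (X : Matrix τ ι ℝ)
    {U : Matrix κ τ ℝ} (hU : Uᵀ * U = 1) : frobNorm (U * X) = frobNorm X := by
  rw [← frobNorm_transpose, transpose_mul, frobNorm_mul_transpose_of_orthonormal _ hU,
    frobNorm_transpose]

theorem frobNorm_sq_of_orthonormal [DecidableEq τ] {V : Matrix κ τ ℝ} (hV : Vᵀ * V = 1) :
    frobNorm V ^ 2 = Fintype.card τ := by
  rw [← frobNorm_transpose, frobNorm_sq_eq_trace, transpose_transpose, hV, trace_one]

/-- Multiplication by an orthogonal projection does not increase the Frobenius norm. -/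
theorem frobNorm_mul_projection_le (X : Matrix ι κ ℝ) {P : Matrix κ κ ℝ} (hP : P * P = P)
    (hPt : Pᵀ = P) : frobNorm (X * P) ≤ frobNorm X := by
  have h := frobNorm_sq_add (X := X * P) (Y := X - X * P) (by
    rw [transpose_sub, transpose_mul, hPt, Matrix.mul_sub, ← Matrix.mul_assoc (X * P) P,
      Matrix.mul_assoc X P P, hP, sub_self])
  rw [add_sub_cancel] at h
  exact le_of_sq_le_sq (by nlinarith [sq_nonneg (frobNorm (X - X * P))]) (frobNorm_nonneg _)

/-- Multiplication by `1 - P`, for an orthogonal projection `P`. -/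
theorem frobNorm_sub_mul_projection_le (X : Matrix ι κ ℝ) {P : Matrix κ κ ℝ} (hP : P * P = P)
    (hPt : Pᵀ = P) : frobNorm (X - X * P) ≤ frobNorm X := by
  classical
  have := frobNorm_mul_projection_le X (P := 1 - P) (by
    simp [Matrix.sub_mul, Matrix.mul_sub, hP]) (by simp [hPt])
  simpa [Matrix.mul_sub] using this

theorem specNorm_nonneg [DecidableEq κ] (A : Matrix ι κ ℝ) : 0 ≤ specNorm A := norm_nonneg _

theorem sum_mulVec_sq_le [DecidableEq κ] (A : Matrix ι κ ℝ) (x : κ → ℝ) :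
    ∑ i, (A *ᵥ x) i ^ 2 ≤ specNorm A ^ 2 * ∑ j, x j ^ 2 := by
  have h := (LinearMap.toContinuousLinearMap (Matrix.toEuclideanLin A)).le_opNorm
    (WithLp.toLp 2 x)
  have h2 := pow_le_pow_left₀ (norm_nonneg _) h 2
  rw [mul_pow, EuclideanSpace.norm_sq_eq, EuclideanSpace.norm_sq_eq] at h2
  simpa [specNorm, Matrix.toLpLin_apply] using h2

theorem frobNorm_mul_transpose_sq_le [DecidableEq κ] (X : Matrix τ κ ℝ) (A : Matrix ι κ ℝ) :
    frobNorm (X * Aᵀ) ^ 2 ≤ frobNorm X ^ 2 * specNorm A ^ 2 := by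
  rw [frobNorm_sq, frobNorm_sq, Finset.sum_mul]
  refine Finset.sum_le_sum fun i _ => ?_
  have h := sum_mulVec_sq_le A (X i)
  rw [mul_comm]
  refine le_trans (le_of_eq ?_) h
  refine Finset.sum_congr rfl fun j _ => ?_
  simp [Matrix.mul_apply, mulVec, dotProduct, mul_comm]

theorem specNorm_le_frobNorm [DecidableEq κ] (A : Matrix ι κ ℝ) : specNorm A ≤ frobNorm A := by
  refine ContinuousLinearMap.opNorm_le_bound _ (frobNorm_nonneg _) fun x => ?_
  refine le_of_sq_le_sq ?_ (mul_nonneg (frobNorm_nonneg _) (norm_nonneg _))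
  rw [mul_pow, EuclideanSpace.norm_sq_eq, EuclideanSpace.norm_sq_eq, frobNorm_sq, Finset.sum_mul]
  refine Finset.sum_le_sum fun i _ => ?_
  have := Finset.sum_mul_sq_le_sq_mul_sq Finset.univ (A i) x.ofLp
  simpa [Matrix.toLpLin_apply, mulVec, dotProduct] using this

theorem frobNorm_sq_le_card_mul [DecidableEq κ] (A : Matrix ι κ ℝ) :
    frobNorm A ^ 2 ≤ Fintype.card ι * specNorm A ^ 2 := by
  rw [frobNorm_sq, ← nsmul_eq_mul]
  refine Finset.sum_le_card_nsmul _ _ _ fun i _ => ?_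
  -- test `A` on its own `i`-th row
  have h := sum_mulVec_sq_le A (A i)
  have h1 : (A *ᵥ A i) i ^ 2 ≤ ∑ i', (A *ᵥ A i) i' ^ 2 :=
    Finset.single_le_sum (f := fun i' => (A *ᵥ A i) i' ^ 2) (fun _ _ => sq_nonneg _)
      (Finset.mem_univ i)
  have h2 : (A *ᵥ A i) i = ∑ j, A i j ^ 2 := by
    simp [mulVec, dotProduct, pow_two]
  rw [h2] at h1
  have h0 : 0 ≤ ∑ j, A i j ^ 2 := by positivity
  rcases h0.eq_or_lt with h0 | h0
  · rw [← h0]; positivity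
  · nlinarith [h1.trans h]

end Norms

/-! ### Finite probability -/

section Probability

variable {α : Type*} [Fintype α]

/-- The expectation of a real function under a law on a finite type, as a finite sum. -/
noncomputable def expect (p : PMF α) (φ : α → ℝ) : ℝ := ∑ a, (p a).toReal * φ a

theorem expect_add (p : PMF α) (φ ψ : α → ℝ) :
    expect p (fun a => φ a + ψ a) = expect p φ + expect p ψ := by
  simp [expect, mul_add, Finset.sum_add_distrib]

theorem expect_const_mul (p : PMF α) (c : ℝ) (φ : α → ℝ) :
    expect p (fun a => c * φ a) = c * expect p φ := by
  simp only [expect, Finset.mul_sum]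
  exact Finset.sum_congr rfl fun _ _ => by ring

theorem expect_const (p : PMF α) (c : ℝ) : expect p (fun _ => c) = c := by
  have h : ∑ a, (p a).toReal = 1 := by
    rw [← ENNReal.toReal_sum fun a _ => p.apply_ne_top a, ← tsum_fintype (L := .unconditional _),
      p.tsum_coe, ENNReal.toReal_one]
  rw [expect, ← Finset.sum_mul, h, one_mul]

theorem expect_sum (p : PMF α) {β : Type*} (s : Finset β) (φ : β → α → ℝ) :
    expect p (fun a => ∑ b ∈ s, φ b a) = ∑ b ∈ s, expect p (φ b) := by
  simp only [expect, Finset.mul_sum]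
  exact Finset.sum_comm

/-- Condition on the first of `N + 1` draws. -/
theorem expect_iid_succ (p : PMF α) (N : ℕ) (φ : (Fin (N + 1) → α) → ℝ) :
    expect (iid p (N + 1)) φ =
      expect p fun a => expect (iid p N) fun f => φ (Fin.cons a f) := by
  simp only [expect, Finset.mul_sum]
  rw [← (Fin.consEquiv fun _ => α).sum_comp, Fintype.sum_prod_type]
  refine Finset.sum_congr rfl fun a _ => Finset.sum_congr rfl fun f _ => ?_
  simp [iid, ENNReal.toReal_mul, ENNReal.toReal_prod, Fin.prod_univ_succ, mul_assoc]
  exact Or.inl (Or.inl rfl)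

theorem expect_iid_sum_sq (p : PMF α) (X : α → ℝ) (hX : expect p X = 0) (N : ℕ) :
    expect (iid p N) (fun f => ∑ t, X (f t)) = 0 ∧
      expect (iid p N) (fun f => (∑ t, X (f t)) ^ 2) = N * expect p fun a => X a ^ 2 := by
  induction N with
  | zero => simp [expect]
  | succ N ih =>
    have h2 : ∀ a, expect (iid p N) (fun f => X a + ∑ t, X (f t)) = X a := fun a => by
      rw [expect_add, expect_const, ih.1, add_zero]
    have h3 : ∀ a, expect (iid p N) (fun f => (X a + ∑ t, X (f t)) ^ 2) =
        X a ^ 2 + N * expect p fun a => X a ^ 2 := fun a => by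
      have : (fun f : Fin N → α => (X a + ∑ t, X (f t)) ^ 2) =
          fun f => (X a ^ 2 + (2 * X a) * ∑ t, X (f t)) + (∑ t, X (f t)) ^ 2 := by
        funext f; ring
      rw [this, expect_add, expect_add, expect_const, expect_const_mul, ih.1, ih.2]
      ring
    simp only [expect_iid_succ, Fin.sum_univ_succ, Fin.cons_zero, Fin.cons_succ, h2, h3, hX]
    refine ⟨trivial, ?_⟩
    rw [expect_add, expect_const]
    push_cast
    ring

theorem expect_iid_mean_sq_le (p : PMF α) (X : α → ℝ) {N : ℕ} (hN : 0 < N) :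
    expect (iid p N) (fun f => ((N : ℝ)⁻¹ * ∑ t, X (f t) - expect p X) ^ 2) ≤
      (expect p fun a => X a ^ 2) / N := by
  have hN' : (0 : ℝ) < N := by exact_mod_cast hN
  have hY := (expect_iid_sum_sq p (fun a => X a + -expect p X)
    (by rw [expect_add, expect_const, add_neg_cancel]) N).2
  have h1 : ∀ f : Fin N → α, ((N : ℝ)⁻¹ * ∑ t, X (f t) - expect p X) ^ 2 =
      ((N : ℝ)⁻¹) ^ 2 * (∑ t, (X (f t) + -expect p X)) ^ 2 := fun f => by
    rw [Finset.sum_add_distrib, ← mul_pow]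
    simp
    field_simp
    ring
  have h2 : expect p (fun a => (X a + -expect p X) ^ 2) ≤ expect p fun a => X a ^ 2 := by
    have : (fun a => (X a + -expect p X) ^ 2) =
        fun a => (X a ^ 2 + (-2 * expect p X) * X a) + expect p X ^ 2 := by
      funext a; ring
    rw [this, expect_add, expect_add, expect_const, expect_const_mul]
    nlinarith [sq_nonneg (expect p X)]
  simp only [h1]
  rw [expect_const_mul, hY, div_eq_inv_mul]
  calc _ = (N : ℝ)⁻¹ * expect p (fun a => (X a + -expect p X) ^ 2) := by field_simp
    _ ≤ _ := by gcongr

/-- The mean of `N` independent random matrices has variance at most `1 / N` times the second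
moment of one of them, in the Frobenius norm. -/
theorem expect_iid_frobNorm_mean_sq_le {ι κ : Type*} [Fintype ι] [Fintype κ] (p : PMF α)
    (Z : α → Matrix ι κ ℝ) {N : ℕ} (hN : 0 < N) :
    expect (iid p N) (fun f => frobNorm ((N : ℝ)⁻¹ • ∑ t, Z (f t) - ∑ a, (p a).toReal • Z a) ^ 2) ≤
      (expect p fun a => frobNorm (Z a) ^ 2) / N := by
  simp only [frobNorm_sq, expect_sum, Finset.sum_div]
  refine Finset.sum_le_sum fun i _ => Finset.sum_le_sum fun j _ => ?_
  have := expect_iid_mean_sq_le p (fun a => Z a i j) hN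
  simpa [Matrix.sum_apply, expect] using this

/-- Markov's inequality.  For `lam = 0` it says that a nonnegative function with mean zero
vanishes almost surely. -/
theorem toOuterMeasure_lt_le (p : PMF α) {Φ : α → ℝ} (hΦ : ∀ a, 0 ≤ Φ a) {lam η : ℝ}
    (hlam : 0 ≤ lam) (hη : 0 ≤ η) (h : expect p Φ ≤ η * lam) :
    p.toOuterMeasure {a | lam < Φ a} ≤ ENNReal.ofReal η := by
  classical
  have hw : ∀ a, 0 ≤ (p a).toReal * Φ a := fun a => mul_nonneg ENNReal.toReal_nonneg (hΦ a)
  have hs : p.toOuterMeasure {a | lam < Φ a} =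
      ENNReal.ofReal (∑ a, if lam < Φ a then (p a).toReal else 0) := by
    rw [PMF.toOuterMeasure_apply_fintype, ENNReal.ofReal_sum_of_nonneg (fun a _ => by
      split_ifs <;> positivity)]
    refine Finset.sum_congr rfl fun a _ => ?_
    simp only [Set.indicator_apply, Set.mem_ofPred_eq]
    split_ifs
    · rw [ENNReal.ofReal_toReal (p.apply_ne_top a)]
    · simp
  rw [hs]
  refine ENNReal.ofReal_le_ofReal ?_
  rcases hlam.eq_or_lt with rfl | hlam
  · rw [mul_zero] at h
    refine (Finset.sum_nonpos fun a _ => ?_).trans hη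
    have ha : (p a).toReal * Φ a ≤ 0 :=
      (Finset.single_le_sum (fun a _ => hw a) (Finset.mem_univ a)).trans h
    split_ifs with h1
    · by_contra! h2
      exact absurd ha (not_le.2 (mul_pos h2 h1))
    · exact le_rfl
  · rw [← mul_le_mul_iff_left₀ hlam, Finset.sum_mul]
    refine le_trans (Finset.sum_le_sum fun a _ => ?_) h
    split_ifs with h1
    · exact mul_le_mul_of_nonneg_left h1.le ENNReal.toReal_nonneg
    · simpa using hw a

theorem toOuterMeasure_iid_forall (p : PMF α) (N : ℕ) (s : Set α) :
    (iid p N).toOuterMeasure {f | ∀ t, f t ∈ s} = p.toOuterMeasure s ^ N := by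
  classical
  simp only [PMF.toOuterMeasure_apply_fintype]
  rw [Finset.sum_pow', Fintype.piFinset_univ]
  refine Finset.sum_congr rfl fun f _ => ?_
  simp only [Set.indicator_apply, Set.mem_ofPred_eq, iid, PMF.ofFintype_apply]
  by_cases h : ∀ t, f t ∈ s
  · simp [h]
  · rw [if_neg h]
    push Not at h
    obtain ⟨t, ht⟩ := h
    exact (Finset.prod_eq_zero (Finset.mem_univ t) (if_neg ht)).symm

theorem one_sub_le_toOuterMeasure {β : Type*} (p : PMF β) {s : Set β} {x : ℝ} (hx : 0 ≤ x)
    (h : p.toOuterMeasure sᶜ ≤ ENNReal.ofReal x) :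
    ENNReal.ofReal (1 - x) ≤ p.toOuterMeasure s := by
  have h1 : (1 : ℝ≥0∞) = p.toOuterMeasure Set.univ := by
    exact ((PMF.toOuterMeasure_apply_eq_one_iff p _).2 (Set.subset_univ _)).symm
  have h2 : (1 : ℝ≥0∞) ≤ p.toOuterMeasure s + p.toOuterMeasure sᶜ := by
    rw [h1, ← Set.union_compl_self s]
    exact MeasureTheory.measure_union_le _ _
  rw [ENNReal.ofReal_sub _ hx, ENNReal.ofReal_one, tsub_le_iff_right]
  exact h2.trans (by gcongr)

/-- Two-stage failure: if the first stage lands in `s` with probability at most `x`, and outside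
`s` the second stage fails with conditional probability at most `y`, then the whole fails with
probability at most `x + y`. -/
theorem toOuterMeasure_bind_le {β : Type*} (p : PMF α) (f : α → PMF β) (s : Set α) (u : Set β)
    {x y : ℝ≥0∞} (hx : p.toOuterMeasure s ≤ x) (hy : ∀ a ∉ s, (f a).toOuterMeasure u ≤ y) :
    (p.bind f).toOuterMeasure u ≤ x + y := by
  classical
  rw [PMF.toOuterMeasure_bind_apply, tsum_fintype]
  have hle : ∀ a, (f a).toOuterMeasure u ≤ 1 := fun a =>
    ((f a).toOuterMeasure.mono (Set.subset_univ u)).trans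
      ((PMF.toOuterMeasure_apply_eq_one_iff (f a) _).2 (Set.subset_univ _)).le
  calc ∑ a, p a * (f a).toOuterMeasure u ≤ ∑ a, (s.indicator p a + p a * y) := by
        refine Finset.sum_le_sum fun a _ => ?_
        by_cases ha : a ∈ s
        · rw [Set.indicator_of_mem ha]
          exact (mul_le_of_le_one_right' (hle a)).trans le_self_add
        · rw [Set.indicator_of_notMem ha, zero_add]
          gcongr
          exact hy a ha
    _ = p.toOuterMeasure s + y := by
        rw [Finset.sum_add_distrib, ← Finset.sum_mul, ← PMF.toOuterMeasure_apply_fintype,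
          ← tsum_fintype (L := .unconditional _) (fun a => p a), p.tsum_coe, one_mul]
    _ ≤ x + y := by gcongr

end Probability

/-! ### Sampling blocks of coordinates -/

section Sampling

variable {n G : ℕ} (blk : Fin n → Fin G)

/-- The coordinate projection `E_i E_iᵀ` onto the block `i`. -/
noncomputable def blockProj (i : Fin G) : Matrix (Fin n) (Fin n) ℝ :=
  diagonal fun j => if blk j = i then 1 else 0

/-- The random matrix `S Sᵀ = (1 / N) ∑ E_{J t} E_{J t}ᵀ / p_{J t}` of a sampling and scaling
matrix `S` for the drawn blocks `J`; its mean is the identity if no `p_i` vanishes. -/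
noncomputable def sampleGram (p : Fin G → ℝ) {N : ℕ} (J : Fin N → Fin G) :
    Matrix (Fin n) (Fin n) ℝ :=
  (N : ℝ)⁻¹ • ∑ t, (p (J t))⁻¹ • blockProj blk (J t)

theorem sum_blockProj : ∑ i, blockProj blk i = 1 := by
  ext a b
  rw [Matrix.sum_apply]
  by_cases h : a = b <;> simp [blockProj, Matrix.one_apply, h]

theorem transpose_blockE_mul_blockE (i : Fin G) : (blockE blk i)ᵀ * blockE blk i = 1 := by
  ext a b
  simp [blockE, Matrix.mul_apply, Matrix.one_apply, Subtype.ext_iff]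

theorem blockE_mul_transpose (i : Fin G) :
    blockE blk i * (blockE blk i)ᵀ = blockProj blk i := by
  ext a b
  have h := Finset.sum_subtype_eq_sum_filter (s := Finset.univ) (p := fun j => blk j = i)
    (fun j => if a = j then (if b = j then (1 : ℝ) else 0) else 0)
  simp only [Finset.subtype_univ] at h
  simp only [blockE, Matrix.mul_apply, Matrix.submatrix_apply, Matrix.one_apply, id,
    Matrix.transpose_apply, ite_mul, one_mul, zero_mul]
  rw [h, Finset.sum_filter]
  simp only [blockProj, Matrix.diagonal_apply]
  rw [Finset.sum_eq_single a]
  · by_cases hab : a = b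
    · simp [hab]
    · simp [hab, Ne.symm hab]
  · intro c _ hc
    simp [hc.symm]
  · simp

theorem blockProj_mul_self (i : Fin G) : blockProj blk i * blockProj blk i = blockProj blk i := by
  simp [blockProj]

theorem sum_frobNorm_mul_blockProj_sq {ι : Type*} [Fintype ι] (X : Matrix ι (Fin n) ℝ) :
    ∑ i, frobNorm (X * blockProj blk i) ^ 2 = frobNorm X ^ 2 := by
  simp only [frobNorm_sq, blockProj, Matrix.mul_diagonal]
  rw [Finset.sum_comm]
  refine Finset.sum_congr rfl fun a _ => ?_
  rw [Finset.sum_comm]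
  simp

/-- Approximate matrix multiplication by sampling: if the probabilities dominate the leverage of
the blocks up to the factor `β`, then `X S Sᵀ V` has mean `X V` and variance at most
`β ‖X‖_F² / N`. -/
theorem expect_sampleGram_sub_sq_le {ι κ : Type*} [Fintype ι] [Fintype κ] (π : PMF (Fin G))
    (X : Matrix ι (Fin n) ℝ) (V : Matrix (Fin n) κ ℝ) {β : ℝ} (hβ : 0 ≤ β)
    (h : ∀ i, frobNorm (X * blockProj blk i * V) ^ 2 ≤
      β * (π i).toReal * frobNorm (X * blockProj blk i) ^ 2) {N : ℕ} (hN : 0 < N) :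
    expect (iid π N) (fun J =>
      frobNorm (X * sampleGram blk (fun i => (π i).toReal) J * V - X * V) ^ 2) ≤
      β * frobNorm X ^ 2 / N := by
  have h0 : ∀ i, (π i).toReal = 0 → X * blockProj blk i * V = 0 := fun i hi => by
    have := h i
    rw [hi] at this
    rw [← frobNorm_eq_zero]
    nlinarith [sq_nonneg (frobNorm (X * blockProj blk i * V))]
  set Z : Fin G → Matrix ι κ ℝ := fun i => ((π i).toReal)⁻¹ • (X * blockProj blk i * V) with hZ
  have hmean : ∑ i, (π i).toReal • Z i = X * V := by
    have : ∀ i, (π i).toReal • Z i = X * blockProj blk i * V := fun i => by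
      by_cases hi : (π i).toReal = 0
      · simp [h0 i hi, hi]
      · simp [hZ, smul_smul, hi]
    simp only [this]
    rw [← Matrix.sum_mul, ← Matrix.mul_sum, sum_blockProj, Matrix.mul_one]
  have hsum : ∀ J : Fin N → Fin G, X * sampleGram blk (fun i => (π i).toReal) J * V =
      (N : ℝ)⁻¹ • ∑ t, Z (J t) := fun J => by
    simp [sampleGram, hZ, Matrix.mul_sum, Matrix.sum_mul]
  have hvar := expect_iid_frobNorm_mean_sq_le π Z hN
  simp only [hsum]
  rw [hmean] at hvar
  refine hvar.trans ?_
  gcongr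
  rw [← sum_frobNorm_mul_blockProj_sq blk X, Finset.mul_sum]
  refine Finset.sum_le_sum fun i _ => ?_
  have hs : frobNorm (Z i) ^ 2 = ((π i).toReal)⁻¹ ^ 2 * frobNorm (X * blockProj blk i * V) ^ 2 := by
    simp [hZ, frobNorm_sq, mul_pow, Finset.mul_sum]
  simp only [hs]
  rcases (ENNReal.toReal_nonneg (a := π i)).eq_or_lt with hi | hi
  · rw [← hi]
    simp only [zero_mul]
    positivity
  · calc _ = ((π i).toReal)⁻¹ * frobNorm (X * blockProj blk i * V) ^ 2 := by field_simp
      _ ≤ ((π i).toReal)⁻¹ * (β * (π i).toReal * frobNorm (X * blockProj blk i) ^ 2) := by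
        gcongr
        exact h i
      _ = _ := by field_simp

theorem blockSampling_mul_transpose {g : ℕ} {p : Fin G → ℝ} (hp : ∀ i, 0 ≤ p i)
    (J : Fin g → Fin G) :
    blockSampling blk p J * (blockSampling blk p J)ᵀ = sampleGram blk p J := by
  ext a b
  simp only [sampleGram, Matrix.smul_apply, Matrix.sum_apply, smul_eq_mul, Finset.mul_sum,
    Matrix.mul_apply, Fintype.sum_sigma, blockSampling, Matrix.transpose_apply]
  refine Finset.sum_congr rfl fun t _ => ?_
  rw [← blockE_mul_transpose]
  simp only [Matrix.mul_apply, Finset.mul_sum, blockE, Matrix.submatrix_apply, Matrix.one_apply,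
    Matrix.transpose_apply, id]
  refine Finset.sum_congr rfl fun c _ => ?_
  have hs : √((g : ℝ) * p (J t)) * √(g * p (J t)) = g * p (J t) :=
    Real.mul_self_sqrt (mul_nonneg (Nat.cast_nonneg g) (hp _))
  by_cases h1 : a = c.1
  · by_cases h2 : b = c.1
    · simp only [if_pos h1, if_pos h2]
      rw [div_mul_div_comm, hs]
      simp [mul_comm]
    · simp [h2]
  · simp [h1]

theorem rowSampling_mul_transpose {m r : ℕ} (ρ : Fin r → Fin m) :
    rowSampling ρ * (rowSampling ρ)ᵀ = sampleGram id (fun _ => 1 / (m : ℝ)) ρ := by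
  have hs : √((r : ℝ) * (1 / m)) * √((r : ℝ) * (1 / m)) = r * (1 / m) :=
    Real.mul_self_sqrt (by positivity)
  ext a b
  simp only [sampleGram, Matrix.smul_apply, Matrix.sum_apply, smul_eq_mul, Finset.mul_sum,
    Matrix.mul_apply, rowSampling, Matrix.transpose_apply, blockProj, Matrix.diagonal_apply, id]
  refine Finset.sum_congr rfl fun t _ => ?_
  by_cases h1 : a = b
  · subst h1
    by_cases h2 : a = ρ t
    · simp only [h2, if_true]
      rw [div_mul_div_comm, hs]
      simp [mul_comm]
    · simp [h2]
  · by_cases h2 : a = ρ t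
    · have : ¬ b = ρ t := fun h => h1 (h2.trans h.symm)
      simp [h1, this]
    · simp [h1, h2]

theorem frobNorm_mul_blockProj_mul_sq_le {ι : Type*} [Fintype ι] {q : ℕ}
    (X : Matrix ι (Fin n) ℝ) (V : Matrix (Fin n) (Fin q) ℝ) (i : Fin G) :
    frobNorm (X * blockProj blk i * V) ^ 2 ≤
      frobNorm (X * blockProj blk i) ^ 2 * specNorm (Vᵀ * blockE blk i) ^ 2 := by
  have h := frobNorm_mul_transpose_sq_le (X * blockE blk i) (Vᵀ * blockE blk i)
  rw [← frobNorm_mul_transpose_of_orthonormal (X * blockE blk i)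
    (transpose_blockE_mul_blockE blk i)] at h
  rw [← blockE_mul_transpose]
  simpa [Matrix.mul_assoc] using h

end Sampling

section StableRank

variable {n q G : ℕ} (blk : Fin n → Fin G) {V : Matrix (Fin n) (Fin q) ℝ}

theorem bddBelow_stableRank :
    BddBelow (Set.range fun i : {i : Fin G // Vᵀ * blockE blk i ≠ 0} =>
      frobNorm (Vᵀ * blockE blk i.1) ^ 2 / specNorm (Vᵀ * blockE blk i.1) ^ 2) :=
  ⟨0, by rintro _ ⟨i, rfl⟩; positivity⟩

theorem specNorm_sq_pos {ι κ : Type*} [Fintype ι] [Fintype κ] [DecidableEq κ]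
    {M : Matrix ι κ ℝ} (hM : M ≠ 0) : 0 < specNorm M ^ 2 := by
  have h := frobNorm_sq_le_card_mul M
  have h0 : 0 < frobNorm M ^ 2 :=
    pow_pos ((frobNorm_nonneg M).lt_of_ne' fun h => hM (frobNorm_eq_zero.1 h)) 2
  by_contra! h1
  nlinarith [mul_nonneg (Nat.cast_nonneg (α := ℝ) (Fintype.card ι)) (sub_nonneg.2 h1)]

theorem nonempty_block (hV : Vᵀ * V = 1) (hq : 0 < q) :
    Nonempty {i : Fin G // Vᵀ * blockE blk i ≠ 0} := by
  by_contra h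
  rw [nonempty_subtype] at h
  push Not at h
  have := sum_blockScore blk V hV
  simp [blockScore, h, frobNorm] at this
  exact hq.ne (by exact_mod_cast this)

theorem one_le_blockStableRank (hV : Vᵀ * V = 1) (hq : 0 < q) : 1 ≤ blockStableRank blk V := by
  have := nonempty_block blk hV hq
  refine le_ciInf fun i => ?_
  rw [one_le_div (specNorm_sq_pos i.2)]
  exact pow_le_pow_left₀ (specNorm_nonneg _) (specNorm_le_frobNorm _) 2

theorem blockStableRank_le (hV : Vᵀ * V = 1) (hq : 0 < q) : blockStableRank blk V ≤ q := by
  obtain ⟨i⟩ := nonempty_block blk hV hq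
  refine (ciInf_le (bddBelow_stableRank blk) i).trans ?_
  rw [div_le_iff₀ (specNorm_sq_pos i.2)]
  simpa using frobNorm_sq_le_card_mul (Vᵀ * blockE blk i.1)

/-- The block leverage probabilities dominate `‖Vᵀ E_i‖_2²` up to the factor `q / α`. -/
theorem specNorm_sq_le_blockProb (hV : Vᵀ * V = 1) (hq : 0 < q) (i : Fin G) :
    specNorm (Vᵀ * blockE blk i) ^ 2 ≤ q / blockStableRank blk V * blockProb blk V i := by
  have hα : 0 < blockStableRank blk V := zero_lt_one.trans_le (one_le_blockStableRank blk hV hq)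
  have hq' : (0 : ℝ) < q := by exact_mod_cast hq
  have : q / blockStableRank blk V * blockProb blk V i =
      frobNorm (Vᵀ * blockE blk i) ^ 2 / blockStableRank blk V := by
    rw [blockProb, blockScore]
    field_simp
  rw [this, le_div_iff₀ hα]
  by_cases hi : Vᵀ * blockE blk i = 0
  · have h := specNorm_le_frobNorm (Vᵀ * blockE blk i)
    rw [frobNorm_eq_zero.2 hi] at h
    rw [le_antisymm h (specNorm_nonneg _)]
    simp [sq_nonneg]
  · have h := ciInf_le (bddBelow_stableRank blk) (⟨i, hi⟩ : {i : Fin G // Vᵀ * blockE blk i ≠ 0})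
    rwa [le_div_iff₀ (specNorm_sq_pos hi), mul_comm] at h

theorem blockProb_nonneg (V : Matrix (Fin n) (Fin q) ℝ) (i : Fin G) : 0 ≤ blockProb blk V i :=
  div_nonneg (sq_nonneg _) (Nat.cast_nonneg q)

/-- Sampling blocks with the leverage scores of `V`. -/
theorem expect_blockLaw_le {ι : Type*} [Fintype ι] (hV : Vᵀ * V = 1) (hq : 0 < q)
    (X : Matrix ι (Fin n) ℝ) {g : ℕ} (hg : 0 < g) :
    expect (iid (blockLaw blk V hV hq) g) (fun J =>
      frobNorm (X * sampleGram blk (blockProb blk V) J * V - X * V) ^ 2) ≤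
      q / blockStableRank blk V * frobNorm X ^ 2 / g := by
  have hα : 0 < blockStableRank blk V := zero_lt_one.trans_le (one_le_blockStableRank blk hV hq)
  have hp : ∀ i, (blockLaw blk V hV hq i).toReal = blockProb blk V i := fun i => by
    rw [blockLaw, PMF.ofFintype_apply, ENNReal.toReal_ofReal (blockProb_nonneg blk V i)]
  have h := expect_sampleGram_sub_sq_le blk (blockLaw blk V hV hq) X V
    (β := q / blockStableRank blk V) (by positivity) (fun i => by
      rw [hp, mul_comm]
      exact (frobNorm_mul_blockProj_mul_sq_le blk X V i).trans
        (mul_le_mul_of_nonneg_left (specNorm_sq_le_blockProb blk hV hq i) (sq_nonneg _))) hg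
  simpa only [hp] using h

end StableRank

/-- Sampling rows uniformly, for a matrix `U` whose rows have squared norm at most `c / m`. -/
theorem expect_uniform_le {ι : Type*} [Fintype ι] {m k : ℕ} [NeZero m]
    {U : Matrix (Fin m) (Fin k) ℝ} {c : ℝ} (hc : 0 ≤ c) (hU : ∀ i, ∑ l, U i l ^ 2 ≤ c / m)
    (X : Matrix ι (Fin m) ℝ) {r : ℕ} (hr : 0 < r) :
    expect (iid (PMF.uniformOfFintype (Fin m)) r) (fun ρ =>
      frobNorm (X * sampleGram id (fun _ => 1 / (m : ℝ)) ρ * U - X * U) ^ 2) ≤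
      c * frobNorm X ^ 2 / r := by
  have hp : ∀ i, (PMF.uniformOfFintype (Fin m) i).toReal = 1 / (m : ℝ) := fun i => by
    simp [PMF.uniformOfFintype_apply]
  have h := expect_sampleGram_sub_sq_le id (PMF.uniformOfFintype (Fin m)) X U hc (fun i => by
      rw [hp, ← blockProj_mul_self, ← Matrix.mul_assoc, Matrix.mul_assoc _ _ U]
      refine (pow_le_pow_left₀ (frobNorm_nonneg _) (frobNorm_mul_le _ _) 2).trans ?_
      rw [mul_pow, mul_comm, Matrix.mul_assoc X, blockProj_mul_self]
      refine mul_le_mul_of_nonneg_right (le_trans (le_of_eq ?_) (hU i)) (sq_nonneg _) |>.trans ?_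
      · simp only [frobNorm_sq, blockProj, Matrix.diagonal_mul, id]
        rw [Finset.sum_eq_single i]
        · simp
        · intro b _ hb
          simp [hb]
        · simp
      · rw [mul_one_div]) hr
  simpa only [hp] using h

/-! ### Least squares after sampling -/

section Regression

variable {ι κ : Type*} [Fintype ι] [Fintype κ]

theorem transpose_mul_self_mul_pinv (M : Matrix ι κ ℝ) : Mᵀ * (M * pinv M) = Mᵀ := by
  have h := isPinv_pinv M
  rw [← h.symm_left, ← transpose_mul, h.mul_mul_self]

theorem pinv_mul_self_mul_transpose (M : Matrix ι κ ℝ) : pinv M * M * Mᵀ = Mᵀ := by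
  have h := isPinv_pinv M
  rw [← h.symm_right, ← transpose_mul, ← Matrix.mul_assoc, h.mul_mul_self]

/-- An error `x` that is at most half of itself plus `y` is at most `2 y`. -/
theorem sq_le_four_mul_sq_of_le {x y e : ℝ} (hx : 0 ≤ x) (he : e ^ 2 ≤ 1 / 4)
    (h : x ≤ x * e + y) : x ^ 2 ≤ 4 * y ^ 2 := by
  have h1 : e ≤ 1 / 2 := by nlinarith [sq_nonneg (e - 1 / 2)]
  have h2 : x ≤ 2 * y := by nlinarith
  nlinarith

/-- The span of the sampled rows contains an approximation of `A` that is nearly as good as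
the projection `U Uᵀ A`, once the sampling nearly preserves the columns of `U`: solve the sampled
least squares problem `min_Y ‖Sᵀ (A - U Y)‖_F`. -/
theorem exists_row_approx {m n k : ℕ} (A : Matrix (Fin m) (Fin n) ℝ)
    {U : Matrix (Fin m) (Fin k) ℝ} (hU : Uᵀ * U = 1) (S : Matrix (Fin m) ι ℝ)
    (hS : frobNorm (Uᵀ * (S * Sᵀ) * U - Uᵀ * U) ^ 2 ≤ 1 / 4) :
    ∃ X : Matrix (Fin m) ι ℝ, frobNorm (A - X * (Sᵀ * A)) ^ 2 ≤
      frobNorm (A - U * (Uᵀ * A)) ^ 2 + 4 * frobNorm ((A - U * (Uᵀ * A))ᵀ * (S * Sᵀ) * U -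
        (A - U * (Uᵀ * A))ᵀ * U) ^ 2 := by
  set B := A - U * (Uᵀ * A) with hB
  set Y := pinv (Sᵀ * U) * (Sᵀ * A) with hY
  have hUB : Uᵀ * B = 0 := by
    rw [hB, Matrix.mul_sub, ← Matrix.mul_assoc, hU, Matrix.one_mul, sub_self]
  have hBU : Bᵀ * U = 0 := by simpa using congrArg transpose hUB
  have hnormal : Uᵀ * (S * Sᵀ) * (A - U * Y) = 0 := by
    have h := congrArg (· * (Sᵀ * A)) (transpose_mul_self_mul_pinv (Sᵀ * U))
    simp only [transpose_mul, transpose_transpose, Matrix.mul_assoc] at h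
    rw [Matrix.mul_sub, sub_eq_zero, hY]
    simp only [Matrix.mul_assoc]
    exact h.symm
  set D := Uᵀ * A - Y with hD
  have hres : A - U * Y = B + U * D := by
    rw [hB, hD, Matrix.mul_sub]
    abel
  -- the normal equations as a fixed point equation for `D`, contracting by `hS`
  have hDeq : D = -((Uᵀ * (S * Sᵀ) * U - Uᵀ * U) * D) + -(Uᵀ * (S * Sᵀ) * B) := by
    rw [hres, Matrix.mul_add, ← Matrix.mul_assoc _ U D] at hnormal
    rw [hU, Matrix.sub_mul, Matrix.one_mul, eq_neg_of_add_eq_zero_left hnormal]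
    abel
  have hN : frobNorm (Uᵀ * (S * Sᵀ) * B) = frobNorm (Bᵀ * (S * Sᵀ) * U - Bᵀ * U) := by
    rw [hBU, sub_zero, ← frobNorm_transpose]
    simp [Matrix.mul_assoc]
  have hDle : frobNorm D ^ 2 ≤ 4 * frobNorm (Uᵀ * (S * Sᵀ) * B) ^ 2 := by
    refine sq_le_four_mul_sq_of_le (frobNorm_nonneg _) hS ?_
    conv_lhs => rw [hDeq]
    refine (frobNorm_add_le _ _).trans ?_
    rw [frobNorm_neg, frobNorm_neg, mul_comm (frobNorm D)]
    gcongr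
    exact frobNorm_mul_le _ _
  refine ⟨U * pinv (Sᵀ * U), ?_⟩
  rw [Matrix.mul_assoc, ← hY, hres, frobNorm_sq_add' (by rw [← Matrix.mul_assoc, hBU,
    Matrix.zero_mul]), frobNorm_mul_of_orthonormal _ hU, ← hN]
  gcongr

variable {m n r q : ℕ} (A : Matrix (Fin m) (Fin n) ℝ) (R : Matrix (Fin r) (Fin n) ℝ)

/-- `A R† R` is the best approximation of `A` with rows in the row space of `R`. -/
theorem frobNorm_sub_mul_pinv_mul_le (X : Matrix (Fin m) (Fin r) ℝ) :
    frobNorm (A - A * (pinv R * R)) ≤ frobNorm (A - X * R) := by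
  have h := isPinv_pinv R
  have h1 := frobNorm_sub_mul_projection_le (A - X * R) (P := pinv R * R)
    (by rw [← Matrix.mul_assoc, h.mul_mul_inv]) h.symm_right
  have h2 : X * R * (pinv R * R) = X * R := by
    rw [Matrix.mul_assoc, ← Matrix.mul_assoc R, h.mul_mul_self]
  rw [Matrix.sub_mul, h2] at h1
  convert h1 using 2
  abel

/-- `A S (R S)† R` is nearly as good as `A R† R`, once the sampling nearly preserves the
columns of `V`, which span at least the row space of `R`. -/
theorem frobNorm_sub_curApprox_sq_le (S : Matrix (Fin n) κ ℝ) {V : Matrix (Fin n) (Fin q) ℝ}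
    (hV : Vᵀ * V = 1) (hR : R * (V * Vᵀ) = R)
    (hS : frobNorm (Vᵀ * (S * Sᵀ) * V - Vᵀ * V) ^ 2 ≤ 1 / 4) :
    frobNorm (A - curApprox A R S) ^ 2 ≤ frobNorm (A - A * (pinv R * R)) ^ 2 +
      4 * frobNorm ((A - A * (pinv R * R)) * (S * Sᵀ) * V - (A - A * (pinv R * R)) * V) ^ 2 := by
  have h := isPinv_pinv R
  set P := pinv R * R with hP
  have hPP : P * P = P := by rw [hP, ← Matrix.mul_assoc, h.mul_mul_inv]
  have hPt : Pᵀ = P := h.symm_right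
  have hRP : R * P = R := by rw [hP, ← Matrix.mul_assoc, h.mul_mul_self]
  have hPV : P * (V * Vᵀ) = P := by rw [hP, Matrix.mul_assoc, hR]
  have hVP : V * (Vᵀ * P) = P := by
    have := congrArg transpose hPV
    simpa [hPt, Matrix.mul_assoc] using this
  set B := A - A * P with hB
  have hBP : B * P = 0 := by rw [hB, Matrix.sub_mul, Matrix.mul_assoc, hPP, sub_self]
  set W := A * S * pinv (R * S) with hW
  set D := A * P - W * R with hD
  have hDP : D * P = D := by
    rw [hD, Matrix.sub_mul, Matrix.mul_assoc, hPP, Matrix.mul_assoc, hRP]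
  have hDV : D * V * Vᵀ = D := by
    rw [← hDP, Matrix.mul_assoc, Matrix.mul_assoc, hPV]
  have hres : A - curApprox A R S = B + D := by
    rw [curApprox, ← hW, hB, hD]
    abel
  have hnormal : (B + D) * (S * Sᵀ) * P = 0 := by
    have h1 : (A - W * R) * (S * Sᵀ) * Rᵀ = 0 := by
      have := congrArg (A * S * ·) (pinv_mul_self_mul_transpose (R * S))
      simp only [transpose_mul, Matrix.mul_assoc] at this
      rw [Matrix.sub_mul, Matrix.sub_mul, sub_eq_zero, hW]
      simp only [Matrix.mul_assoc]
      exact this.symm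
    rw [← hres, curApprox, ← hW, ← hPt, hP, transpose_mul, ← Matrix.mul_assoc, h1,
      Matrix.zero_mul]
  -- insert `V Vᵀ`, which acts as the identity next to `P` and `D`
  have hDeq : D = (-(D * V * (Vᵀ * (S * Sᵀ) * V - Vᵀ * V)) +
      -(B * (S * Sᵀ) * V - B * V)) * Vᵀ * P := by
    have e1 : D * V * (Vᵀ * (S * Sᵀ) * V - Vᵀ * V) * Vᵀ * P = D * (S * Sᵀ) * P - D := by
      rw [hV, Matrix.mul_sub, Matrix.mul_one, Matrix.sub_mul, Matrix.sub_mul, hDV, hDP]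
      congr 1
      calc _ = (D * V * Vᵀ) * (S * Sᵀ) * (V * (Vᵀ * P)) := by simp only [Matrix.mul_assoc]
        _ = _ := by rw [hDV, hVP]
    have e2 : (B * (S * Sᵀ) * V - B * V) * Vᵀ * P = B * (S * Sᵀ) * P := by
      rw [Matrix.sub_mul, Matrix.sub_mul, Matrix.mul_assoc _ Vᵀ, Matrix.mul_assoc _ V,
        Matrix.mul_assoc _ Vᵀ, Matrix.mul_assoc B V, hVP, hBP, sub_zero]
    rw [Matrix.add_mul, Matrix.add_mul] at hnormal
    rw [Matrix.add_mul, Matrix.add_mul, Matrix.neg_mul, Matrix.neg_mul, Matrix.neg_mul,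
      Matrix.neg_mul, e1, e2, eq_neg_of_add_eq_zero_left hnormal]
    abel
  have hDle : frobNorm D ^ 2 ≤ 4 * frobNorm (B * (S * Sᵀ) * V - B * V) ^ 2 := by
    refine sq_le_four_mul_sq_of_le (frobNorm_nonneg _) hS ?_
    conv_lhs => rw [hDeq]
    refine (frobNorm_mul_projection_le _ hPP hPt).trans ?_
    rw [frobNorm_mul_transpose_of_orthonormal _ hV]
    refine (frobNorm_add_le _ _).trans ?_
    rw [frobNorm_neg, frobNorm_neg]
    gcongr
    refine (frobNorm_mul_le _ _).trans_eq ?_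
    rw [← frobNorm_mul_transpose_of_orthonormal (D * V) hV, hDV]
  rw [hres, frobNorm_sq_add (by
    rw [← hDP, transpose_mul, hPt, ← Matrix.mul_assoc, hBP, Matrix.zero_mul])]
  gcongr

end Regression

/-! ### The truncated singular value decomposition -/

namespace SVD

variable {m n q : ℕ} {A : Matrix (Fin m) (Fin n) ℝ}

theorem transpose_topU_mul_U (D : SVD A q) (k : ℕ) (hk : k ≤ q) :
    (D.topU k hk)ᵀ * D.U = (1 : Matrix (Fin q) (Fin q) ℝ).submatrix (Fin.castLE hk) id := by
  rw [← D.orthonormal_U]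
  ext i j
  simp [topU, Matrix.mul_apply]

theorem orthonormal_topU (D : SVD A q) (k : ℕ) (hk : k ≤ q) :
    (D.topU k hk)ᵀ * D.topU k hk = 1 := by
  have h := congrArg (fun M => M.submatrix id (Fin.castLE hk)) (D.transpose_topU_mul_U k hk)
  ext i j
  have := congrFun (congrFun h i) j
  simp only [Matrix.submatrix_apply, Matrix.one_apply, id, Matrix.mul_apply] at this
  simpa [Matrix.mul_apply, topU, Matrix.one_apply] using this

/-- The truncation is the projection of `A` onto the top left singular vectors. -/
theorem trunc_eq (D : SVD A q) (k : ℕ) (hk : k ≤ q) :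
    D.trunc k hk = D.topU k hk * ((D.topU k hk)ᵀ * A) := by
  have h : (D.topU k hk)ᵀ * A = diagonal (fun i => D.σ (Fin.castLE hk i)) * (D.topV k hk)ᵀ := by
    rw [congrArg ((D.topU k hk)ᵀ * ·) D.eq, ← Matrix.mul_assoc, ← Matrix.mul_assoc,
      transpose_topU_mul_U]
    ext i j
    simp [Matrix.mul_apply, Matrix.diagonal_apply, topV, Matrix.one_apply]
  rw [h, trunc, Matrix.mul_assoc]

theorem mul_V_mul_transpose (D : SVD A q) : A * (D.V * D.Vᵀ) = A := by
  refine (congrArg (· * (D.V * D.Vᵀ)) D.eq).trans (Eq.trans ?_ D.eq.symm)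
  rw [Matrix.mul_assoc _ D.Vᵀ, ← Matrix.mul_assoc D.Vᵀ, D.orthonormal_V, Matrix.one_mul]

theorem le_rows (D : SVD A q) : q ≤ m := by
  have h1 := Matrix.rank_mul_le_right D.Uᵀ D.U
  rw [D.orthonormal_U, Matrix.rank_one] at h1
  simpa using h1.trans (Matrix.rank_le_card_height D.U)

theorem sum_topU_sq_le [NeZero m] (D : SVD A q) {k : ℕ} (hk0 : 0 < k) (hk : k ≤ q) {μ₀ : ℝ}
    (hμ : D.incoherence k hk ≤ μ₀) (i : Fin m) :
    ∑ l, D.topU k hk i l ^ 2 ≤ μ₀ * k / m := by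
  have hm : (0 : ℝ) < m := by exact_mod_cast Nat.pos_of_ne_zero (NeZero.ne m)
  have hk' : (0 : ℝ) < k := by exact_mod_cast hk0
  have h1 := le_ciSup (f := fun i => ∑ l, D.topU k hk i l ^ 2) (Set.finite_range _).bddAbove i
  have h2 := (mul_le_mul_of_nonneg_left h1 (by positivity : (0 : ℝ) ≤ m / k)).trans hμ
  rw [le_div_iff₀ hm]
  rw [div_mul_eq_mul_div, div_le_iff₀ hk'] at h2
  linarith

/-- The coherence is at least `1`, since the squared row norms of `U_k` add up to `k`. -/
theorem one_le_of_incoherence_le [NeZero m] (D : SVD A q) {k : ℕ} (hk0 : 0 < k) (hk : k ≤ q)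
    {μ₀ : ℝ} (hμ : D.incoherence k hk ≤ μ₀) : 1 ≤ μ₀ := by
  have hm : (0 : ℝ) < m := by exact_mod_cast Nat.pos_of_ne_zero (NeZero.ne m)
  have hk' : (0 : ℝ) < k := by exact_mod_cast hk0
  have h := frobNorm_sq_of_orthonormal (D.orthonormal_topU k hk)
  rw [frobNorm_sq, Fintype.card_fin] at h
  have h2 : (k : ℝ) ≤ ∑ _i : Fin m, μ₀ * k / m :=
    h.symm.trans_le <| Finset.sum_le_sum fun i _ => D.sum_topU_sq_le hk0 hk hμ i
  rw [Finset.sum_const, Finset.card_univ, Fintype.card_fin, nsmul_eq_mul,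
    mul_div_cancel₀ _ hm.ne'] at h2
  nlinarith

end SVD

/-! ### The algorithm -/

section Algorithm

theorem ofReal_add_self (x : ℝ) (hx : 0 ≤ x) :
    ENNReal.ofReal x + ENNReal.ofReal x = ENNReal.ofReal (2 * x) := by
  rw [← ENNReal.ofReal_add hx hx, two_mul]

/-- With enough uniform rows, projecting onto the row space of `R` loses only a factor `1 + ε²` in
the squared error against `A_k`, except with probability at most `1 / 8`. -/
theorem toOuterMeasure_rows_le {m n k r : ℕ} [NeZero m] {A : Matrix (Fin m) (Fin n) ℝ}
    (D : SVD A A.rank) (hk0 : 0 < k) (hk : k ≤ A.rank) {μ₀ : ℝ}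
    (hμ : D.incoherence k hk ≤ μ₀) {ε : ℝ} (hε : ε ∈ Set.Ioo (0 : ℝ) 1)
    (hr : 64 * (μ₀ * k ^ 2 / ε ^ 2) ≤ r) :
    (iid (PMF.uniformOfFintype (Fin m)) r).toOuterMeasure
      {ρ | ¬ frobNorm (A - A * (pinv (rowMatrix A ρ) * rowMatrix A ρ)) ^ 2 ≤
        (1 + ε ^ 2) * frobNorm (A - D.trunc k hk) ^ 2} ≤ ENNReal.ofReal (1 / 8) := by
  have hε0 : 0 < ε := hε.1
  have hμ1 := D.one_le_of_incoherence_le hk0 hk hμ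
  have hk1 : (1 : ℝ) ≤ k := by exact_mod_cast hk0
  have hr' : (0 : ℝ) < r := lt_of_lt_of_le (by positivity) hr
  have hr0 : 0 < r := by exact_mod_cast hr'
  rw [mul_div_assoc', div_le_iff₀ (by positivity)] at hr
  have hε2 : ε ^ 2 ≤ 1 := pow_le_one₀ hε0.le hε.2.le
  set U := D.topU k hk with hUdef
  have hU : Uᵀ * U = 1 := D.orthonormal_topU k hk
  rw [D.trunc_eq k hk, ← hUdef]
  set B := A - U * (Uᵀ * A) with hB
  set Γ : (Fin r → Fin m) → Matrix (Fin m) (Fin m) ℝ :=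
    fun ρ => sampleGram id (fun _ => 1 / (m : ℝ)) ρ with hΓ
  have hexp : ∀ {ι : Type} [Fintype ι] (X : Matrix ι (Fin m) ℝ),
      expect (iid (PMF.uniformOfFintype (Fin m)) r)
        (fun ρ => frobNorm (X * Γ ρ * U - X * U) ^ 2) ≤ μ₀ * k * frobNorm X ^ 2 / r :=
    fun X => expect_uniform_le (by positivity) (D.sum_topU_sq_le hk0 hk hμ) X hr0
  -- both second moments are at most `ε² / 64` of the scale, so that each of the two thresholds
  -- `1 / 4` and `ε² / 4` is exceeded with probability at most `1 / 16`
  have h1 := toOuterMeasure_lt_le (iid (PMF.uniformOfFintype (Fin m)) r)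
    (Φ := fun ρ => frobNorm (Uᵀ * Γ ρ * U - Uᵀ * U) ^ 2) (fun _ => sq_nonneg _)
    (lam := 1 / 4) (η := 1 / 16) (by norm_num) (by norm_num) ((hexp Uᵀ).trans (by
      rw [frobNorm_transpose, frobNorm_sq_of_orthonormal hU, Fintype.card_fin,
        div_le_iff₀ hr']
      nlinarith))
  have h2 := toOuterMeasure_lt_le (iid (PMF.uniformOfFintype (Fin m)) r)
    (Φ := fun ρ => frobNorm (Bᵀ * Γ ρ * U - Bᵀ * U) ^ 2) (fun _ => sq_nonneg _)
    (lam := ε ^ 2 / 4 * frobNorm B ^ 2) (η := 1 / 16) (by positivity) (by norm_num)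
    ((hexp Bᵀ).trans (by
      rw [frobNorm_transpose, div_le_iff₀ hr']
      have h : μ₀ * k ≤ μ₀ * k ^ 2 := by
        rw [pow_two, ← mul_assoc]
        exact le_mul_of_one_le_right (by positivity) hk1
      have h' : μ₀ * k ≤ 1 / 16 * (ε ^ 2 / 4) * r := by linarith
      calc μ₀ * k * frobNorm B ^ 2 ≤ 1 / 16 * (ε ^ 2 / 4) * r * frobNorm B ^ 2 := by gcongr
        _ = _ := by ring))
  refine le_trans ((PMF.toOuterMeasure _).mono ?_)
    ((MeasureTheory.measure_union_le _ _).trans ((add_le_add h1 h2).trans_eq ?_))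
  · intro ρ hρ
    by_contra hn
    simp only [Set.mem_union, Set.mem_ofPred_eq, not_or, not_lt] at hn
    refine hρ ?_
    have hS := rowSampling_mul_transpose ρ
    obtain ⟨X, hX⟩ := exists_row_approx A hU (rowSampling ρ) (by rw [hS]; exact hn.1)
    rw [hS] at hX
    calc _ ≤ frobNorm (A - X * rowMatrix A ρ) ^ 2 :=
          pow_le_pow_left₀ (frobNorm_nonneg _) (frobNorm_sub_mul_pinv_mul_le A _ X) 2
      _ ≤ frobNorm B ^ 2 + 4 * frobNorm (Bᵀ * Γ ρ * U - Bᵀ * U) ^ 2 := hX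
      _ ≤ _ := by linarith [hn.2]
  · rw [ofReal_add_self _ (by norm_num)]
    norm_num

variable {m n G r : ℕ} (A : Matrix (Fin m) (Fin n) ℝ) (blk : Fin n → Fin G)

/-- With enough blocks, the squared error of `C U R` is at most `1 + ε²` times that of the
projection `A R† R`, except with probability at most `1 / 8`. -/
theorem toOuterMeasure_blocks_le {R : Matrix (Fin r) (Fin n) ℝ} {q : ℕ} (hq : 0 < q)
    (E : SVD R q) {ε : ℝ} (hε : ε ∈ Set.Ioo (0 : ℝ) 1) {g : ℕ}
    (hg : 64 * (r ^ 2 / (blockStableRank blk E.V * ε ^ 2)) ≤ g) :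
    (iid (blockLaw blk E.V E.orthonormal_V hq) g).toOuterMeasure
      {J | ¬ frobNorm (A - curApprox A R (blockSampling blk (blockProb blk E.V) J)) ^ 2 ≤
        (1 + ε ^ 2) * frobNorm (A - A * (pinv R * R)) ^ 2} ≤ ENNReal.ofReal (1 / 8) := by
  have hε0 : 0 < ε := hε.1
  have hε2 : ε ^ 2 ≤ 1 := pow_le_one₀ hε0.le hε.2.le
  set V := E.V with hVdef
  have hV : Vᵀ * V = 1 := E.orthonormal_V
  set a := blockStableRank blk V with ha
  have ha0 : 0 < a := zero_lt_one.trans_le (one_le_blockStableRank blk hV hq)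
  have hq1 : (1 : ℝ) ≤ q := by exact_mod_cast hq
  have hqr : (q : ℝ) ≤ r := by exact_mod_cast E.le_rows
  have hr1 : (1 : ℝ) ≤ r := hq1.trans hqr
  have hg' : (0 : ℝ) < g := lt_of_lt_of_le (by positivity) hg
  have hg0 : 0 < g := by exact_mod_cast hg'
  rw [mul_div_assoc', div_le_iff₀ (by positivity)] at hg
  have hqq : (q : ℝ) * q ≤ r ^ 2 := by nlinarith
  have hqq' : (q : ℝ) ≤ r ^ 2 := by nlinarith
  set B := A - A * (pinv R * R) with hB
  set Γ : (Fin g → Fin G) → Matrix (Fin n) (Fin n) ℝ :=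
    fun J => sampleGram blk (blockProb blk V) J with hΓ
  have hexp : ∀ {ι : Type} [Fintype ι] (X : Matrix ι (Fin n) ℝ),
      expect (iid (blockLaw blk V hV hq) g)
        (fun J => frobNorm (X * Γ J * V - X * V) ^ 2) ≤ q / a * frobNorm X ^ 2 / g :=
    fun X => expect_blockLaw_le blk hV hq X hg0
  have h1 := toOuterMeasure_lt_le (iid (blockLaw blk V hV hq) g)
    (Φ := fun J => frobNorm (Vᵀ * Γ J * V - Vᵀ * V) ^ 2) (fun _ => sq_nonneg _)
    (lam := 1 / 4) (η := 1 / 16) (by norm_num) (by norm_num) ((hexp Vᵀ).trans (by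
      rw [frobNorm_transpose, frobNorm_sq_of_orthonormal hV, Fintype.card_fin,
        div_le_iff₀ hg', div_mul_eq_mul_div, div_le_iff₀ ha0]
      nlinarith [mul_pos hg' ha0]))
  have h2 := toOuterMeasure_lt_le (iid (blockLaw blk V hV hq) g)
    (Φ := fun J => frobNorm (B * Γ J * V - B * V) ^ 2) (fun _ => sq_nonneg _)
    (lam := ε ^ 2 / 4 * frobNorm B ^ 2) (η := 1 / 16) (by positivity) (by norm_num)
    ((hexp B).trans (by
      rw [div_le_iff₀ hg', div_mul_eq_mul_div, div_le_iff₀ ha0]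
      have h' : (q : ℝ) ≤ 1 / 16 * (ε ^ 2 / 4) * g * a := by linarith
      calc q * frobNorm B ^ 2 ≤ 1 / 16 * (ε ^ 2 / 4) * g * a * frobNorm B ^ 2 := by gcongr
        _ = _ := by ring))
  refine le_trans ((PMF.toOuterMeasure _).mono ?_)
    ((MeasureTheory.measure_union_le _ _).trans ((add_le_add h1 h2).trans_eq ?_))
  · intro J hJ
    by_contra hn
    simp only [Set.mem_union, Set.mem_ofPred_eq, not_or, not_lt] at hn
    refine hJ ?_
    have hS := blockSampling_mul_transpose blk (blockProb_nonneg blk V) J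
    have h := frobNorm_sub_curApprox_sq_le A R (blockSampling blk (blockProb blk V) J) hV
      E.mul_V_mul_transpose (by rw [hS]; exact hn.1)
    rw [hS] at h
    refine h.trans ?_
    linarith [hn.2]
  · rw [ofReal_add_self _ (by norm_num)]
    norm_num

variable {q : (Fin r → Fin m) → ℕ} (svd : ∀ ρ, SVD (rowMatrix A ρ) (q ρ))

/-- A single run fails with probability at most `1 / 4`. -/
theorem toOuterMeasure_run_le {k : ℕ} [NeZero m]
    (D : SVD A A.rank) (hk0 : 0 < k) (hk : k ≤ A.rank) {μ₀ : ℝ}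
    (hμ : D.incoherence k hk ≤ μ₀) {ε : ℝ} (hε : ε ∈ Set.Ioo (0 : ℝ) 1)
    (hr : 64 * (μ₀ * k ^ 2 / ε ^ 2) ≤ r) (hq : ∀ ρ, 0 < q ρ) (g : (Fin r → Fin m) → ℕ)
    (hg : ∀ ρ, 64 * (r ^ 2 / (blockStableRank blk (svd ρ).V * ε ^ 2)) ≤ g ρ) :
    (runLaw A blk svd hq g).toOuterMeasure
      {ω | ¬ frobNorm (A - runOutput A blk svd ω) ≤ (1 + ε) * frobNorm (A - D.trunc k hk)} ≤
      ENNReal.ofReal (1 / 4) := by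
  have hsum : ENNReal.ofReal (1 / 4) = ENNReal.ofReal (1 / 8) + ENNReal.ofReal (1 / 8) := by
    rw [ofReal_add_self _ (by norm_num)]
    norm_num
  rw [hsum]
  refine toOuterMeasure_bind_le _ _ _ _ (toOuterMeasure_rows_le D hk0 hk hμ hε hr) fun ρ hρ => ?_
  rw [Set.mem_ofPred_eq, not_not] at hρ
  rw [PMF.toOuterMeasure_map_apply]
  refine (toOuterMeasure_blocks_le A blk (hq ρ) (svd ρ) hε (hg ρ)).trans'
    ((PMF.toOuterMeasure _).mono fun J hJ hle => hJ ?_)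
  have hε0 : 0 < ε := hε.1
  have hB := frobNorm_nonneg (A - D.trunc k hk)
  refine le_of_sq_le_sq ?_ (by positivity)
  have hε2 : ε ^ 2 ≤ ε := by nlinarith [hε.2]
  calc _ ≤ (1 + ε ^ 2) * ((1 + ε ^ 2) * frobNorm (A - D.trunc k hk) ^ 2) :=
        hle.trans (by gcongr)
    _ = ((1 + ε ^ 2) * frobNorm (A - D.trunc k hk)) ^ 2 := by ring
    _ ≤ _ := by gcongr

/-- The best of `T` runs fails only if every run fails. -/
theorem not_le_of_not_boostedOutput_le {T : ℕ} (hT : 0 < T) {g : (Fin r → Fin m) → ℕ}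
    (ω : Fin T → Run m G r g) {x : ℝ} (h : ¬ frobNorm (A - boostedOutput A blk svd hT ω) ≤ x)
    (t : Fin T) : ¬ frobNorm (A - runOutput A blk svd (ω t)) ≤ x := by
  have : Nonempty (Fin T) := ⟨⟨0, hT⟩⟩
  exact fun ht => h (((Finite.exists_min fun τ =>
    frobNorm (A - runOutput A blk svd (ω τ))).choose_spec t).trans ht)

end Algorithm

theorem quarter_pow_le {δ : ℝ} (hδ : 0 < δ) {T : ℕ} (hT : Real.log (1 / δ) ≤ T) :
    (1 / 4 : ℝ) ^ T ≤ δ := by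
  have h4 : (1 / 4 : ℝ) ≤ Real.exp (-1) := by
    rw [Real.exp_neg, one_div]
    exact inv_anti₀ (Real.exp_pos 1) (by linarith [Real.exp_one_lt_d9])
  rw [one_div, Real.log_inv] at hT
  calc (1 / 4 : ℝ) ^ T ≤ Real.exp (-1) ^ T := by gcongr
    _ = Real.exp (-T) := by rw [← Real.exp_nat_mul]; ring_nf
    _ ≤ Real.exp (Real.log δ) := Real.exp_le_exp.2 (by linarith)
    _ = δ := Real.exp_log hδ

theorem ceil_le_add_one_mul {c x : ℝ} (hc : 0 ≤ c) (hx : 1 ≤ x) :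
    (⌈c * x⌉₊ : ℝ) ≤ (c + 1) * x := by
  have := Nat.ceil_lt_add_one (mul_nonneg hc (zero_le_one.trans hx))
  linarith

end BlockCUR

theorem theorem2 :
    ∃ C K : ℝ, 0 < C ∧ 0 < K ∧
      ∀ (m n G k : ℕ) [NeZero m] (A : Matrix (Fin m) (Fin n) ℝ) (blk : Fin n → Fin G)
        (D : BlockCUR.SVD A A.rank) (_ : 0 < k) (hk : k ≤ A.rank)
        (μ₀ : ℝ) (_ : D.incoherence k hk ≤ μ₀)
        (ε δ : ℝ) (_ : ε ∈ Set.Ioo (0 : ℝ) 1) (_ : δ ∈ Set.Ioo (0 : ℝ) 1),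
        -- the error bound, for all sufficiently large sample sizes
        (∀ (T r : ℕ) (hT : 0 < T)
          (_ : Real.log (1 / δ) ≤ T)
          (_ : C * (μ₀ * k ^ 2 / ε ^ 2) ≤ r)
          (q : (Fin r → Fin m) → ℕ) (hq : ∀ ρ, 0 < q ρ)
          (svd : ∀ ρ, BlockCUR.SVD (BlockCUR.rowMatrix A ρ) (q ρ))
          (g : (Fin r → Fin m) → ℕ)
          (_ : ∀ ρ, C * (r ^ 2 / (BlockCUR.blockStableRank blk (svd ρ).V * ε ^ 2)) ≤ g ρ),
          ENNReal.ofReal (1 - δ) ≤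
            (BlockCUR.iid (BlockCUR.runLaw A blk svd hq g) T).toOuterMeasure
              {ω | BlockCUR.frobNorm (A - BlockCUR.boostedOutput A blk svd hT ω) ≤
                (1 + ε) * BlockCUR.frobNorm (A - D.trunc k hk)}) ∧
        -- such sample sizes exist within the claimed total numbers of rows and blocks
        (∃ T r : ℕ, 0 < T ∧ Real.log (1 / δ) ≤ T ∧
          C * (μ₀ * k ^ 2 / ε ^ 2) ≤ r ∧
          (T * r : ℝ) ≤ K * (μ₀ * k ^ 2 / ε ^ 2 * max 1 (Real.log (1 / δ))) ∧
          ∀ (q : (Fin r → Fin m) → ℕ) (_ : ∀ ρ, 0 < q ρ)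
            (svd : ∀ ρ, BlockCUR.SVD (BlockCUR.rowMatrix A ρ) (q ρ)),
            ∃ g : (Fin r → Fin m) → ℕ, ∀ ρ,
              C * (r ^ 2 / (BlockCUR.blockStableRank blk (svd ρ).V * ε ^ 2)) ≤ g ρ ∧
              (T * g ρ : ℝ) ≤
                K * (r ^ 2 / (BlockCUR.blockStableRank blk (svd ρ).V * ε ^ 2) *
                  max 1 (Real.log (1 / δ)))) := by

  -- rounding up costs a factor `2` for `T` and `65 / 64` for `r` and `g`; `130 = 2 * 65`
  refine ⟨64, 130, by norm_num, by norm_num, ?_⟩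
  intro m n G k _ A blk D hk0 hk μ₀ hμ ε δ hε hδ
  refine ⟨?_, ?_⟩
  · intro T r hT hlog hr q hq svd g hg
    refine BlockCUR.one_sub_le_toOuterMeasure _ hδ.1.le ?_
    have hrun := BlockCUR.toOuterMeasure_run_le A blk svd D hk0 hk hμ hε hr hq g hg
    refine le_trans ?_ ((BlockCUR.toOuterMeasure_iid_forall _ T _).trans_le
      ((pow_le_pow_left' hrun T).trans ?_))
    · exact (PMF.toOuterMeasure _).mono fun ω hω t =>
        BlockCUR.not_le_of_not_boostedOutput_le A blk svd hT ω hω t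
    rw [← ENNReal.ofReal_pow (by norm_num)]
    exact ENNReal.ofReal_le_ofReal (BlockCUR.quarter_pow_le hδ.1 hlog)
  · have hε0 : 0 < ε := hε.1
    have hε2 : ε ^ 2 ≤ 1 := pow_le_one₀ hε0.le hε.2.le
    have hμ1 := D.one_le_of_incoherence_le hk0 hk hμ
    have hk1 : (1 : ℝ) ≤ k := by exact_mod_cast hk0
    set L := max 1 (Real.log (1 / δ)) with hL
    have hL1 : 1 ≤ L := le_max_left _ _
    set x := μ₀ * k ^ 2 / ε ^ 2 with hx
    have hx1 : 1 ≤ x := by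
      rw [hx, le_div_iff₀ (by positivity), one_mul]
      exact hε2.trans (one_le_mul_of_one_le_of_one_le hμ1 (one_le_pow₀ hk1))
    have hT : (⌈1 * L⌉₊ : ℝ) ≤ 2 * L :=
      (BlockCUR.ceil_le_add_one_mul zero_le_one hL1).trans_eq (by norm_num)
    have hTle : L ≤ ⌈1 * L⌉₊ := by simpa using Nat.le_ceil (1 * L)
    have hprod : ∀ y : ℝ, 1 ≤ y → (⌈1 * L⌉₊ * ⌈64 * y⌉₊ : ℝ) ≤ 130 * (y * L) := fun y hy => by
      have h := mul_le_mul hT (BlockCUR.ceil_le_add_one_mul (c := 64) (by norm_num) hy)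
        (Nat.cast_nonneg _) (by positivity)
      exact h.trans_eq (by ring)
    refine ⟨⌈1 * L⌉₊, ⌈64 * x⌉₊, Nat.ceil_pos.2 (by positivity), (le_max_right _ _).trans hTle,
      Nat.le_ceil _, hprod x hx1, ?_⟩
    intro q hq svd
    refine ⟨fun ρ => ⌈64 * (((⌈64 * x⌉₊ : ℕ) : ℝ) ^ 2 /
      (BlockCUR.blockStableRank blk (svd ρ).V * ε ^ 2))⌉₊, fun ρ =>
      ⟨Nat.le_ceil _, hprod _ ?_⟩⟩
    -- the stable rank is at most `q ≤ r`, so that `r ^ 2 / (α ε ^ 2)` is at least `1`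
    have ha := BlockCUR.one_le_blockStableRank blk (svd ρ).orthonormal_V (hq ρ)
    have haq := BlockCUR.blockStableRank_le blk (svd ρ).orthonormal_V (hq ρ)
    have hqr : (q ρ : ℝ) ≤ (⌈64 * x⌉₊ : ℕ) := by exact_mod_cast (svd ρ).le_rows
    rw [le_div_iff₀ (by positivity), one_mul]
    calc _ ≤ BlockCUR.blockStableRank blk (svd ρ).V * 1 := by gcongr
      _ ≤ _ := by nlinarith
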